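/- Let $(M,g)$ be a smooth Riemannian $3$-manifold (without boundary, not necessarily compact). Let $\nabla$ be its Levi-Civita connection with curvature $R$, let $\mathfrak{Ric}(U,V)=\mathrm{tr}[X\mapsto R_{XU}V]$ be the Ricci tensor and $\mathfrak{scal}$ the scalar curvature, and let $\mathfrak{Sch}(g)=\mathfrak{Ric}-\tfrac{\mathfrak{scal}}{4}g$ be the Schouten tensor, viewed also (through $g$) as a $1$-form with values in $TM$. The Cotton form is $d^\nabla\mathfrak{Sch}$, where $(d^\nabla\mathfrak{Sch})(U,V)=\nabla_U(\mathfrak{Sch}(V))-\nabla_V(\mathfrak{Sch}(U))-\mathfrak{Sch}([U,V])$; using the metric to identify its vector values with $1$-forms, it is the covariant $3$-tensor \[\mathfrak{cott}(g)(U,V,W)=g\big((d^\nabla\mathfrak{Sch})(U,V),W\big),\] a $2$-form with values in $T^*M$. If $M$ is oriented, the Cotton tensor is the bilinear form $\mathfrak{Cott}(g)=*\,\mathfrak{cott}(g)$, that is, $\mathfrak{Cott}(g)(\cdot,W)=*\big(\mathfrak{cott}(g)(\cdot,\cdot,W)\big)$, where $*$ is the Hodge star of $g$ from $2$-forms to $1$-forms,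 given in an oriented orthonormal frame by $*(S^2\wedge S^3)=S^1$, $*(S^3\wedge S^1)=S^2$, $*(S^1\wedge S^2)=S^3$. Then for every $f\in C^\infty(M)$ the Cotton form is conformally invariant, \[\mathfrak{cott}(e^{2f}g)=\mathfrak{cott}(g),\] and, if $M$ is oriented, the Cotton tensor is conformally covariant, \[\mathfrak{Cott}(e^{2f}g)=e^{-f}\,\mathfrak{Cott}(g).\] -/

import Mathlib

open scoped Manifold ContDiff Topology

noncomputable section

namespace CottonGeometry

/-- The model space `ℝ³`. -/
abbrev E3 : Type := EuclideanSpace ℝ (Fin 3)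

/-! ### Riemannian geometry in a coordinate domain of `ℝ³`

A metric is given by its matrix of coefficients `G y i j = g(∂ᵢ, ∂ⱼ)(y)`, a vector field
`Y = ∑ₗ Yˡ ∂ₗ` by its components `Y : Fin 3 → E3 → ℝ`. -/

/-- The partial derivative `∂ᵢ φ` at `y`. -/
def pderiv (i : Fin 3) (φ : E3 → ℝ) (y : E3) : ℝ :=
  fderiv ℝ φ y (EuclideanSpace.single i 1)

/-- The Christoffel symbol `Γˡᵢⱼ = ½ ∑ₘ gˡᵐ (∂ᵢ gⱼₘ + ∂ⱼ gᵢₘ - ∂ₘ gᵢⱼ)` of the Levi-Civita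
connection. -/
def christoffel (G : E3 → Matrix (Fin 3) (Fin 3) ℝ) (l i j : Fin 3) (y : E3) : ℝ :=
  1 / 2 * ∑ m, (G y)⁻¹ l m *
    (pderiv i (fun z => G z j m) y + pderiv j (fun z => G z i m) y
      - pderiv m (fun z => G z i j) y)

/-- The Levi-Civita covariant derivative `∇_{∂ᵢ} Y` of a vector field `Y`, given by components. -/
def covDeriv (G : E3 → Matrix (Fin 3) (Fin 3) ℝ) (i : Fin 3) (Y : Fin 3 → E3 → ℝ) :
    Fin 3 → E3 → ℝ :=
  fun l y => pderiv i (Y l) y + ∑ m, christoffel G l i m y * Y m y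

/-- The components of the coordinate vector field `∂ₖ`. -/
def coordField (k : Fin 3) : Fin 3 → E3 → ℝ :=
  fun l _ => if l = k then 1 else 0

/-- The curvature `R_{∂ᵢ ∂ⱼ} ∂ₖ = ∇_{∂ᵢ} ∇_{∂ⱼ} ∂ₖ - ∇_{∂ⱼ} ∇_{∂ᵢ} ∂ₖ`, a vector field. -/
def curvature (G : E3 → Matrix (Fin 3) (Fin 3) ℝ) (i j k : Fin 3) : Fin 3 → E3 → ℝ :=
  fun l y => covDeriv G i (covDeriv G j (coordField k)) l y
    - covDeriv G j (covDeriv G i (coordField k)) l y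

/-- The Ricci tensor `Ric(U, V) = tr (X ↦ R_{XU} V)` on `U = ∂ⱼ`, `V = ∂ₖ`. -/
def ricci (G : E3 → Matrix (Fin 3) (Fin 3) ℝ) (j k : Fin 3) (y : E3) : ℝ :=
  ∑ i, curvature G i j k i y

/-- The scalar curvature, the trace of the Ricci tensor with respect to the metric. -/
def scalarCurvature (G : E3 → Matrix (Fin 3) (Fin 3) ℝ) (y : E3) : ℝ :=
  ∑ j, ∑ k, (G y)⁻¹ j k * ricci G j k y

/-- The Schouten tensor `Sch = Ric - (scal / 4) g` in dimension three, as a bilinear form. -/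
def schouten (G : E3 → Matrix (Fin 3) (Fin 3) ℝ) (j k : Fin 3) (y : E3) : ℝ :=
  ricci G j k y - scalarCurvature G y / 4 * G y j k

/-- The Schouten tensor as a `1`-form with values in vector fields: `Sch(∂ⱼ)` is the vector field
with `g(Sch(∂ⱼ), ∂ₖ) = Sch(∂ⱼ, ∂ₖ)`. -/
def schoutenField (G : E3 → Matrix (Fin 3) (Fin 3) ℝ) (j : Fin 3) : Fin 3 → E3 → ℝ :=
  fun l y => ∑ k, (G y)⁻¹ l k * schouten G j k y

/-- The twisted exterior differential of a `1`-form `α` with values in vector fields,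
`(d^∇ α)(∂ᵢ, ∂ⱼ) = ∇_{∂ᵢ} (α(∂ⱼ)) - ∇_{∂ⱼ} (α(∂ᵢ))` (coordinate vector fields commute). -/
def extCovDeriv (G : E3 → Matrix (Fin 3) (Fin 3) ℝ) (α : Fin 3 → Fin 3 → E3 → ℝ) (i j : Fin 3) :
    Fin 3 → E3 → ℝ :=
  fun l y => covDeriv G i (α j) l y - covDeriv G j (α i) l y

/-- The Cotton form `d^∇ Sch` as a covariant tensor, `g((d^∇ Sch)(∂ᵢ, ∂ⱼ), ∂ₖ)`. -/
def cottonComponent (G : E3 → Matrix (Fin 3) (Fin 3) ℝ) (i j k : Fin 3) (y : E3) : ℝ :=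
  ∑ l, extCovDeriv G (schoutenField G) i j l y * G y l k

/-! ### The Hodge star from `2`-forms to `1`-forms in dimension three -/

/-- The Hodge star of a `2`-form `α` on a three-dimensional space with scalar product `g` and
orientation `o`, written in a basis `e`: it is
`± det (g(eᵢ, eⱼ))^(-1/2) ∑ᵢ g(u, eᵢ) α(eᵢ₊₁, eᵢ₊₂)` (indices modulo three), where the sign is `+`
if and only if `e` is positively oriented. By `hodgeStar_orthonormal` below it is the usual Hodge
star, for every choice of `e`. -/
def hodgeStar {V : Type*} [AddCommGroup V] [Module ℝ V] (e : Module.Basis (Fin 3) ℝ V)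
    (o : Orientation ℝ V (Fin 3)) (g α : V → V → ℝ) (u : V) : ℝ :=
  open scoped Classical in
  (if e.orientation = o then 1 else -1) / √(Matrix.det (Matrix.of fun i j => g (e i) (e j)))
    * ∑ i, g u (e i) * α (e (i + 1)) (e (i + 2))

/-- In an oriented orthonormal frame `S₁, S₂, S₃`, the Hodge star is given by
`*(S²∧S³) = S¹`, `*(S³∧S¹) = S²`, `*(S¹∧S²) = S³`, whatever auxiliary basis `e` was used. -/
theorem hodgeStar_orthonormal {V : Type*} [AddCommGroup V] [Module ℝ V]
    (e S : Module.Basis (Fin 3) ℝ V) (g α : V →ₗ[ℝ] V →ₗ[ℝ] ℝ)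
    (hS : ∀ i j, g (S i) (S j) = if i = j then 1 else 0) (hα : ∀ v, α v v = 0) (i : Fin 3) :
    hodgeStar e S.orientation (fun v w => g v w) (fun v w => α v w) (S i)
      = α (S (i + 1)) (S (i + 2)) := by
  have hanti : ∀ v w, α v w = - α w v := by
    intro v w
    have h := hα (v + w)
    simp only [map_add, LinearMap.add_apply, hα] at h
    linarith
  set A : Matrix (Fin 3) (Fin 3) ℝ := S.toMatrix e with hA
  have he : ∀ j, e j = A 0 j • S 0 + A 1 j • S 1 + A 2 j • S 2 := by
    intro j
    have h := S.sum_toMatrix_smul_self e j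
    rw [Fin.sum_univ_three] at h
    exact h.symm
  have hg : ∀ k j, g (S k) (e j) = A k j := by
    intro k j
    rw [he j]
    fin_cases k <;> simp [hS]
  have hgram : (Matrix.of fun i j => g (e i) (e j)) = A.transpose * A := by
    ext a b
    rw [Matrix.mul_apply, Fin.sum_univ_three]
    simp only [Matrix.of_apply, Matrix.transpose_apply]
    conv_lhs => rw [he a]
    simp only [map_add, map_smul, LinearMap.add_apply, LinearMap.smul_apply, hg, smul_eq_mul]
  have hdet : S.det e = A.det := by rw [Module.Basis.det_apply]
  have hne : A.det ≠ 0 := by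
    rw [← hdet]
    exact (S.isUnit_det e).ne_zero
  have hsqrt : √(Matrix.det (Matrix.of fun i j => g (e i) (e j))) = |A.det| := by
    rw [hgram, Matrix.det_mul, Matrix.det_transpose, ← sq, Real.sqrt_sq_eq_abs]
  have hsum : ∑ j, g (S i) (e j) * α (e (j + 1)) (e (j + 2))
      = A.det * α (S (i + 1)) (S (i + 2)) := by
    have key : ∀ a b, α (e a) (e b) =
        (A 1 a * A 2 b - A 2 a * A 1 b) * α (S 1) (S 2)
        + (A 2 a * A 0 b - A 0 a * A 2 b) * α (S 2) (S 0)
        + (A 0 a * A 1 b - A 1 a * A 0 b) * α (S 0) (S 1) := by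
      intro a b
      rw [he a, he b]
      simp only [map_add, map_smul, LinearMap.add_apply, LinearMap.smul_apply, smul_eq_mul, hα]
      rw [hanti (S 2) (S 1), hanti (S 0) (S 2), hanti (S 1) (S 0)]
      ring
    simp only [hg, key, Fin.sum_univ_three, Matrix.det_fin_three]
    fin_cases i <;> simp <;> ring
  unfold hodgeStar
  rw [hsqrt, hsum]
  have hor : e.orientation = S.orientation ↔ 0 < A.det := by
    rw [eq_comm, Module.Basis.orientation_eq_iff_det_pos, hdet]
  rcases lt_or_gt_of_ne hne with h | h
  · rw [if_neg (by rw [hor]; exact not_lt.mpr h.le), abs_of_neg h]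
    field_simp
  · rw [if_pos (hor.mpr h), abs_of_pos h]
    field_simp

/-! ### Smooth three-dimensional manifolds -/

/-- Smooth Riemannian metrics on the three-dimensional manifold `M`. -/
abbrev Metric3 (M : Type*) [TopologicalSpace M] [ChartedSpace E3 M] [IsManifold (𝓡 3) ∞ M] :
    Type _ :=
  Bundle.ContMDiffRiemannianMetric (𝓡 3) ∞ E3 (fun x : M => TangentSpace (𝓡 3) x)

variable {M : Type*} [TopologicalSpace M] [ChartedSpace E3 M] [IsManifold (𝓡 3) ∞ M]

/-- The conformal metric `e^{2f} g`. -/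
def conformal (g : Metric3 M) (f : C^∞⟮𝓡 3, M; 𝓘(ℝ, ℝ), ℝ⟯) : Metric3 M where
  inner x := Real.exp (2 * f x) • g.inner x
  symm x v w := by
    simp [g.symm x v w]
  pos x v hv := by
    simpa using mul_pos (Real.exp_pos (2 * f x)) (g.pos x v hv)
  isVonNBounded x := by
    have h := Bornology.IsVonNBounded.image (g.isVonNBounded x)
      (Real.exp (-f x) • ContinuousLinearMap.id ℝ (TangentSpace (𝓡 3) x))
    refine h.subset ?_
    intro v hv
    refine ⟨Real.exp (f x) • v, ?_, ?_⟩
    · have h2 : Real.exp (2 * f x) = Real.exp (f x) * Real.exp (f x) := by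
        rw [← Real.exp_add]; ring_nf
      simp only [Set.mem_ofPred_eq, _root_.smul_apply, smul_eq_mul, map_smul] at hv ⊢
      rw [h2] at hv
      linarith
    · simp [smul_smul, ← Real.exp_add]
  contMDiff := by
    have hf : ContMDiff (𝓡 3) 𝓘(ℝ, ℝ) ∞ (fun x : M => Real.exp (2 * f x)) :=
      (Real.contDiff_exp.contMDiff).comp (contMDiff_const.mul f.contMDiff)
    exact hf.smul_section g.contMDiff

/-- The coordinate vector `∂ᵢ` at the point with coordinates `y` in the chart at `c`. -/
def coordVector (c : M) (i : Fin 3) (y : E3) :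
    TangentSpace (𝓡 3) ((extChartAt (𝓡 3) c).symm y) :=
  mfderiv 𝓘(ℝ, E3) (𝓡 3) (extChartAt (𝓡 3) c).symm y (EuclideanSpace.single i (1 : ℝ) : E3)

/-- The matrix of coefficients `g(∂ᵢ, ∂ⱼ)` of `g` in the chart at `c`. -/
def chartMetric (g : Metric3 M) (c : M) (y : E3) : Matrix (Fin 3) (Fin 3) ℝ :=
  Matrix.of fun i j =>
    g.inner ((extChartAt (𝓡 3) c).symm y) (coordVector c i y) (coordVector c j y)

/-- The components `uⁱ` of a tangent vector `u = ∑ᵢ uⁱ ∂ᵢ` at `x` in the chart at `x`. -/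
def coords (x : M) (u : TangentSpace (𝓡 3) x) : E3 :=
  mfderiv (𝓡 3) 𝓘(ℝ, E3) (extChartAt (𝓡 3) x) x u

/-- The Cotton form `cott(g) = d^∇ Sch` as a covariant tensor: `cottonForm g x u v w` is
`g((d^∇ Sch)(u, v), w)`, for `u, v, w` tangent to `M` at `x`. -/
def cottonForm (g : Metric3 M) (x : M) (u v w : TangentSpace (𝓡 3) x) : ℝ :=
  ∑ i, ∑ j, ∑ k, coords x u i * coords x v j * coords x w k *
    cottonComponent (chartMetric g x) i j k (extChartAt (𝓡 3) x x)

/-- The Cotton tensor `Cott(g) = * d^∇ Sch` as a bilinear form on the tangent space at `x`, where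
`*` is the Hodge star of `(T_x M, g_x)`, with the orientation `o x`, acting on the two form
arguments of `d^∇ Sch`. Only the orientation of `T_x M` enters, so no continuity of `o` is asked. -/
def cottonTensor (g : Metric3 M) (o : ∀ x : M, Orientation ℝ (TangentSpace (𝓡 3) x) (Fin 3))
    (x : M) (u w : TangentSpace (𝓡 3) x) : ℝ :=
  hodgeStar (V := TangentSpace (𝓡 3) x) (EuclideanSpace.basisFun (Fin 3) ℝ).toBasis (o x)
    (fun a b => g.inner x a b) (fun a b => cottonForm g x a b w) u

end CottonGeometry

end

/-! The Cotton form is tensorial, so it suffices to compare components in one chart, where `g` and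
`e^{2f} g` have coefficient matrices `G` and `expScale φ G`, with `φ` the coordinate expression of
`f`.

The Christoffel symbols change by `δˡᵢ ∂ⱼφ + δˡⱼ ∂ᵢφ - gᵢⱼ gradˡ φ` (`christoffel_expScale`).
Inserted in the curvature, this adds the Kulkarni–Nomizu product of `g` with `Q = -∇dφ + dφ ⊗ dφ - ½
|dφ|² g` (`curvature_expScale`), and after taking traces the Schouten tensor becomes `Sch + Q`
(`schouten_expScale`).

The Cotton form is `(∇ᵢ Sch)(∂ⱼ, ∂ₖ) - (∇ⱼ Sch)(∂ᵢ, ∂ₖ)`. Its variation has two parts linear in `φ`.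
Antisymmetrizing `-∇∇dφ` gives the curvature applied to `dφ`, by the Ricci identity; the change of
connection acting on `Sch` gives products of `dφ`, `Sch` and `g`. In dimension three the Weyl tensor
vanishes (`curvatureTensor_eq_of_dim_three`), the curvature is the Kulkarni–Nomizu product of `g`
with `Sch`, and the two parts cancel. The terms of higher order in `φ` cancel without any curvature
identity. This is `cottonComponent_expScale`.

The Cotton tensor then only sees the scaling of the Hodge star from `2`-forms to `1`-forms, which is
`e^{-f}` (`hodgeStar_scale`). -/

noncomputable section

namespace CottonGeometry

/-! ### Calculus of partial derivatives of smooth functions. -/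

section PartialDerivatives

variable {φ ψ : E3 → ℝ} {y : E3}

theorem differentiableAt_of_smooth (hφ : ContDiffAt ℝ ∞ φ y) : DifferentiableAt ℝ φ y :=
  hφ.differentiableAt (by simp)

theorem contDiffAt_pderiv (hφ : ContDiffAt ℝ ∞ φ y) (i : Fin 3) :
    ContDiffAt ℝ ∞ (pderiv i φ) y :=
  (hφ.fderiv_right (m := ∞) le_rfl).clm_apply contDiffAt_const

theorem pderiv_const (i : Fin 3) (c : ℝ) : pderiv i (fun _ => c) y = 0 := by
  simp [pderiv]

theorem pderiv_add (hφ : ContDiffAt ℝ ∞ φ y) (hψ : ContDiffAt ℝ ∞ ψ y) (i : Fin 3) :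
    pderiv i (fun z => φ z + ψ z) y = pderiv i φ y + pderiv i ψ y := by
  simp [pderiv, fderiv_fun_add (differentiableAt_of_smooth hφ) (differentiableAt_of_smooth hψ)]

theorem pderiv_sub (hφ : ContDiffAt ℝ ∞ φ y) (hψ : ContDiffAt ℝ ∞ ψ y) (i : Fin 3) :
    pderiv i (fun z => φ z - ψ z) y = pderiv i φ y - pderiv i ψ y := by
  simp [pderiv, fderiv_fun_sub (differentiableAt_of_smooth hφ) (differentiableAt_of_smooth hψ)]

theorem pderiv_mul (hφ : ContDiffAt ℝ ∞ φ y) (hψ : ContDiffAt ℝ ∞ ψ y) (i : Fin 3) :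
    pderiv i (fun z => φ z * ψ z) y = pderiv i φ y * ψ y + φ y * pderiv i ψ y := by
  simp [pderiv, fderiv_fun_mul (differentiableAt_of_smooth hφ) (differentiableAt_of_smooth hψ)]
  ring

theorem pderiv_const_mul (c : ℝ) (hφ : ContDiffAt ℝ ∞ φ y) (i : Fin 3) :
    pderiv i (fun z => c * φ z) y = c * pderiv i φ y := by
  rw [pderiv_mul contDiffAt_const hφ, pderiv_const, zero_mul, zero_add]

theorem pderiv_sum {F : Fin 3 → E3 → ℝ} (hF : ∀ m, ContDiffAt ℝ ∞ (F m) y) (i : Fin 3) :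
    pderiv i (fun z => ∑ m, F m z) y = ∑ m, pderiv i (F m) y := by
  simp [pderiv, fderiv_fun_sum fun m _ => differentiableAt_of_smooth (hF m)]

theorem pderiv_exp (hφ : ContDiffAt ℝ ∞ φ y) (i : Fin 3) :
    pderiv i (fun z => Real.exp (φ z)) y = Real.exp (φ y) * pderiv i φ y := by
  simp [pderiv, fderiv_exp (differentiableAt_of_smooth hφ)]

theorem pderiv_congr (h : φ =ᶠ[𝓝 y] ψ) (i : Fin 3) : pderiv i φ y = pderiv i ψ y := by
  rw [pderiv, h.fderiv_eq, pderiv]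

theorem pderiv_congr_on {U : Set E3} (hU : IsOpen U) (hy : y ∈ U) (h : ∀ z ∈ U, φ z = ψ z)
    (i : Fin 3) : pderiv i φ y = pderiv i ψ y :=
  pderiv_congr (Filter.eventually_of_mem (hU.mem_nhds hy) h) i

theorem pderiv_comm (hφ : ContDiffAt ℝ ∞ φ y) (i j : Fin 3) :
    pderiv i (pderiv j φ) y = pderiv j (pderiv i φ) y := by
  have hd : DifferentiableAt ℝ (fderiv ℝ φ) y :=
    (hφ.fderiv_right (m := ∞) le_rfl).differentiableAt (by simp)
  have hs : IsSymmSndFDerivAt ℝ φ y := hφ.isSymmSndFDerivAt (by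
    simpa using WithTop.coe_le_coe.2 (le_top : (2 : ℕ∞) ≤ ⊤))
  have key : ∀ a b : Fin 3, pderiv a (pderiv b φ) y
      = fderiv ℝ (fderiv ℝ φ) y (EuclideanSpace.single a 1) (EuclideanSpace.single b 1) := by
    intro a b
    have h := fderiv_clm_apply hd (differentiableAt_const (EuclideanSpace.single b (1 : ℝ)))
    unfold pderiv
    rw [h]
    simp
  rw [key, key, hs]

end PartialDerivatives

/-! ### The Levi-Civita connection of a metric in coordinates. -/

/-- `G` is the matrix of coefficients of a smooth nondegenerate metric on the open set `U`. -/
structure IsMetricOn (G : E3 → Matrix (Fin 3) (Fin 3) ℝ) (U : Set E3) : Prop where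
  isOpen : IsOpen U
  smooth : ∀ y ∈ U, ∀ i j, ContDiffAt ℝ ∞ (fun z => G z i j) y
  symm : ∀ y ∈ U, ∀ i j, G y i j = G y j i
  det_ne_zero : ∀ y ∈ U, (G y).det ≠ 0

namespace IsMetricOn

variable {G : E3 → Matrix (Fin 3) (Fin 3) ℝ} {U : Set E3} {y : E3}

theorem sum_inv_mul (hG : IsMetricOn G U) (hy : y ∈ U) (i j : Fin 3) :
    ∑ m, (G y)⁻¹ i m * G y m j = if i = j then 1 else 0 := by
  rw [← Matrix.mul_apply, Matrix.nonsing_inv_mul _ (isUnit_iff_ne_zero.2 (hG.det_ne_zero y hy)),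
    Matrix.one_apply]

theorem inv_symm (hG : IsMetricOn G U) (hy : y ∈ U) (i j : Fin 3) :
    (G y)⁻¹ i j = (G y)⁻¹ j i := by
  have h : (G y).transpose = G y := by ext a b; exact hG.symm y hy b a
  have h2 := congrFun (congrFun (Matrix.transpose_nonsing_inv (G y)) i) j
  rw [h, Matrix.transpose_apply] at h2
  exact h2.symm

/-- Cramer's rule: the entries of the inverse are polynomials in the entries of `G`, divided by a
determinant that does not vanish. -/
theorem smooth_inv (hG : IsMetricOn G U) (hy : y ∈ U) (i j : Fin 3) :
    ContDiffAt ℝ ∞ (fun z => (G z)⁻¹ i j) y := by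
  have hs := hG.smooth y hy
  have hdet : ContDiffAt ℝ ∞ (fun z => (G z).det) y := by
    simp only [Matrix.det_fin_three]
    fun_prop
  have hadj : ContDiffAt ℝ ∞ (fun z => (G z).adjugate i j) y := by
    have hrow : ∀ a b, ContDiffAt ℝ ∞
        (fun z => (G z).updateRow j (Pi.single i 1) a b) y := by
      intro a b
      simp only [Matrix.updateRow_apply]
      split_ifs
      · exact contDiffAt_const
      · exact hs a b
    simp only [Matrix.adjugate_apply, Matrix.det_fin_three]
    fun_prop
  simp only [Matrix.inv_def, Ring.inverse_eq_inv', Matrix.smul_apply, smul_eq_mul]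
  exact (hdet.inv (hG.det_ne_zero y hy)).mul hadj

theorem smooth_christoffel (hG : IsMetricOn G U) (hy : y ∈ U) (l i j : Fin 3) :
    ContDiffAt ℝ ∞ (christoffel G l i j) y := by
  have hp : ∀ a b c, ContDiffAt ℝ ∞ (pderiv a (fun z => G z b c)) y := fun a b c =>
    contDiffAt_pderiv (hG.smooth y hy b c) a
  exact contDiffAt_const.mul (ContDiffAt.sum fun m _ =>
    (hG.smooth_inv hy l m).mul (((hp i j m).add (hp j i m)).sub (hp m i j)))

/-- Vector fields are determined by their scalar products with the coordinate fields. -/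
theorem eq_of_lower_eq (hG : IsMetricOn G U) (hy : y ∈ U) {v w : Fin 3 → ℝ}
    (h : ∀ k, ∑ l, v l * G y l k = ∑ l, w l * G y l k) (l : Fin 3) : v l = w l := by
  have key : Matrix.vecMul v (G y) = Matrix.vecMul w (G y) := by
    ext k
    simpa [Matrix.vecMul, dotProduct] using h k
  have h2 := congrArg (fun u => Matrix.vecMul u (G y)⁻¹) key
  simp only [Matrix.vecMul_vecMul,
    Matrix.mul_nonsing_inv _ (isUnit_iff_ne_zero.2 (hG.det_ne_zero y hy)), Matrix.vecMul_one] at h2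
  exact congrFun h2 l

theorem lower_raise (hG : IsMetricOn G U) (hy : y ∈ U) (α : Fin 3 → ℝ) (k : Fin 3) :
    ∑ l, (∑ m, (G y)⁻¹ l m * α m) * G y l k = α k := by
  have : ∀ m, ∑ l, (G y)⁻¹ l m * α m * G y l k = α m * if m = k then 1 else 0 := by
    intro m
    rw [← hG.sum_inv_mul hy m k, Finset.mul_sum]
    refine Finset.sum_congr rfl fun l _ => ?_
    rw [hG.inv_symm hy l m]; ring
  simp only [Finset.sum_mul]
  rw [Finset.sum_comm]
  simp [this]

theorem christoffel_symm (hG : IsMetricOn G U) (hy : y ∈ U) (l i j : Fin 3) :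
    christoffel G l i j y = christoffel G l j i y := by
  have h : ∀ m, pderiv m (fun z => G z i j) y = pderiv m (fun z => G z j i) y := fun m =>
    pderiv_congr_on hG.isOpen hy (fun z hz => hG.symm z hz i j) m
  unfold christoffel
  congr 1
  refine Finset.sum_congr rfl fun m _ => ?_
  rw [h m]; ring

/-- The Koszul formula for coordinate fields. -/
theorem lower_christoffel (hG : IsMetricOn G U) (hy : y ∈ U) (i j k : Fin 3) :
    ∑ l, christoffel G l i j y * G y l k = 1 / 2 *
      (pderiv i (fun z => G z j k) y + pderiv j (fun z => G z i k) y
        - pderiv k (fun z => G z i j) y) := by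
  rw [← hG.lower_raise hy (fun k => pderiv i (fun z => G z j k) y + pderiv j (fun z => G z i k) y
        - pderiv k (fun z => G z i j) y) k, Finset.mul_sum]
  refine Finset.sum_congr rfl fun l _ => ?_
  rw [christoffel]; ring

/-- The Levi-Civita connection is metric. -/
theorem pderiv_metric (hG : IsMetricOn G U) (hy : y ∈ U) (i j k : Fin 3) :
    pderiv i (fun z => G z j k) y = ∑ m, christoffel G m i j y * G y m k
      + ∑ m, christoffel G m i k y * G y j m := by
  have h : ∀ m a b, pderiv m (fun z => G z a b) y = pderiv m (fun z => G z b a) y := fun m a b =>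
    pderiv_congr_on hG.isOpen hy (fun z hz => hG.symm z hz a b) m
  simp only [hG.symm y hy j]
  rw [hG.lower_christoffel hy, hG.lower_christoffel hy, h i k j]
  ring

/-- Lowering the index commutes with the covariant derivative. -/
theorem lower_covDeriv (hG : IsMetricOn G U) (hy : y ∈ U) {Y : Fin 3 → E3 → ℝ}
    (hY : ∀ l, ContDiffAt ℝ ∞ (Y l) y) (i k : Fin 3) :
    ∑ l, covDeriv G i Y l y * G y l k = pderiv i (fun z => ∑ l, Y l z * G z l k) y
      - ∑ m, christoffel G m i k y * ∑ l, Y l y * G y l m := by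
  have h1 := fun a b => hG.smooth y hy a b
  rw [pderiv_sum (fun m => (hY m).mul (h1 m k))]
  simp only [pderiv_mul (hY _) (h1 _ _), hG.pderiv_metric hy, covDeriv, Fin.sum_univ_three]
  ring

end IsMetricOn

theorem covDeriv_coordField (G : E3 → Matrix (Fin 3) (Fin 3) ℝ) (j k l : Fin 3) :
    covDeriv G j (coordField k) l = christoffel G l j k := by
  funext y
  have h : pderiv j (coordField k l) y = 0 := pderiv_const j _
  simp [covDeriv, h, coordField]

theorem curvature_eq (G : E3 → Matrix (Fin 3) (Fin 3) ℝ) (i j k l : Fin 3) (y : E3) :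
    curvature G i j k l y =
      (pderiv i (christoffel G l j k) y + ∑ m, christoffel G l i m y * christoffel G m j k y)
      - (pderiv j (christoffel G l i k) y
        + ∑ m, christoffel G l j m y * christoffel G m i k y) := by
  rw [← covDeriv_coordField, ← covDeriv_coordField]
  simp only [← covDeriv_coordField G j k, ← covDeriv_coordField G i k]
  rfl

theorem curvature_antisymm (G : E3 → Matrix (Fin 3) (Fin 3) ℝ) (i j k l : Fin 3) (y : E3) :
    curvature G i j k l y = -curvature G j i k l y := by
  simp only [curvature]; ring

/-! ### Algebraic curvature tensors in dimension three. -/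

section Algebra

theorem eq_zero_of_antisymm {T : Fin 3 → Fin 3 → ℝ} (h : ∀ i j, T i j = -T j i)
    (h01 : T 0 1 = 0) (h02 : T 0 2 = 0) (h12 : T 1 2 = 0) (i j : Fin 3) : T i j = 0 := by
  have hd : ∀ i, T i i = 0 := fun i => by linarith [h i i]
  fin_cases i <;> fin_cases j <;> simp only [Fin.zero_eta, Fin.mk_one, Fin.reduceFinMk]
  · exact hd 0
  · exact h01
  · exact h02
  · rw [h, h01, neg_zero]
  · exact hd 1
  · exact h12
  · rw [h, h02, neg_zero]
  · rw [h, h12, neg_zero]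
  · exact hd 2

/-- The classical octahedron argument: add the four cyclic identities in which each index in turn is
held fixed, and use both antisymmetries. -/
theorem pair_symm_of_bianchi {R : Fin 3 → Fin 3 → Fin 3 → Fin 3 → ℝ}
    (h1 : ∀ i j k m, R i j k m = -R j i k m) (h2 : ∀ i j k m, R i j k m = -R i j m k)
    (hB : ∀ i j k m, R i j k m + R j k i m + R k i j m = 0) (i j k m : Fin 3) :
    R i j k m = R k m i j := by
  linarith [hB i j k m, hB j k m i, hB k m i j, hB m i j k, h1 i j k m, h2 i j k m,
    h1 k m i j, h2 k m i j, h2 j k i m, h1 j k i m, h2 k i j m, h1 k i j m, h1 j k m i,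
    h2 k m j i, h1 m j k i, h2 m j k i, h1 m i k j, h2 m i k j, h1 i k m j, h2 i k m j,
    h1 i j m k, h2 i j m k, h1 j m i k, h2 j m i k, h1 m i j k, h2 m i j k]

/-- Symmetry of the Ricci tensor. Pair symmetry exchanges the two contracted slots, which is
harmless because `H` is symmetric. -/
theorem contraction_symm_of_bianchi {R : Fin 3 → Fin 3 → Fin 3 → Fin 3 → ℝ}
    {H : Matrix (Fin 3) (Fin 3) ℝ} (hH : ∀ i j, H i j = H j i)
    (h1 : ∀ i j k m, R i j k m = -R j i k m) (h2 : ∀ i j k m, R i j k m = -R i j m k)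
    (hB : ∀ i j k m, R i j k m + R j k i m + R k i j m = 0) (j k : Fin 3) :
    ∑ i, ∑ m, H i m * R i j k m = ∑ i, ∑ m, H i m * R i k j m := by
  rw [Finset.sum_comm]
  refine Finset.sum_congr rfl fun a _ => Finset.sum_congr rfl fun b _ => ?_
  rw [hH b a, pair_symm_of_bianchi h1 h2 hB b j k a, h1 k a b j, h2 a k b j, neg_neg]

set_option linter.unusedSimpArgs false in
/-- In dimension three, an algebraic curvature tensor is determined by its Ricci tensor. -/
theorem curvatureTensor_eq_of_dim_three {R : Fin 3 → Fin 3 → Fin 3 → Fin 3 → ℝ}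
    {g H : Matrix (Fin 3) (Fin 3) ℝ} (hg : ∀ i j, g i j = g j i) (hd : g.det ≠ 0) (hH : H = g⁻¹)
    (h1 : ∀ i j k m, R i j k m = -R j i k m) (h2 : ∀ i j k m, R i j k m = -R i j m k)
    (hB : ∀ i j k m, R i j k m + R j k i m + R k i j m = 0)
    {ric P : Fin 3 → Fin 3 → ℝ} (hric : ∀ j k, ric j k = ∑ i, ∑ m, H i m * R i j k m)
    (hP : ∀ j k, P j k = ric j k - (∑ a, ∑ b, H a b * ric a b) / 4 * g j k)
    (i j k m : Fin 3) :
    R i j k m = g i m * P j k - g j m * P i k + P i m * g j k - P j m * g i k := by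
  have hp := pair_symm_of_bianchi h1 h2 hB
  have hz1 : ∀ i k m, R i i k m = 0 := fun i k m => by linarith [h1 i i k m]
  have hz2 : ∀ i j k, R i j k k = 0 := fun i j k => by linarith [h2 i j k k]
  have hHsymm : ∀ i j, H i j = H j i := by
    intro i j
    have h : g.transpose = g := by ext a b; exact hg b a
    have h2 := congrFun (congrFun (Matrix.transpose_nonsing_inv g) i) j
    rw [h, Matrix.transpose_apply] at h2
    rw [hH]; exact h2.symm
  have hricsymm : ∀ j k, ric j k = ric k j := by
    intro j k
    rw [hric, hric, contraction_symm_of_bianchi hHsymm h1 h2 hB]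
  -- Writing the inverse as adjugate over determinant reduces the claim, multiplied by `g.det`, to
  -- polynomial identities.
  have hadj : ∀ i j, H i j = g.adjugate i j / g.det := by
    intro i j
    rw [hH, Matrix.inv_def, Ring.inverse_eq_inv', Matrix.smul_apply, smul_eq_mul, div_eq_inv_mul]
  have hdet := Matrix.det_fin_three g
  simp only [Matrix.adjugate_fin_three, hg 1 0, hg 2 0, hg 2 1] at hadj hdet
  have e00 := hadj 0 0
  have e01 := hadj 0 1
  have e02 := hadj 0 2
  have e11 := hadj 1 1
  have e12 := hadj 1 2
  have e22 := hadj 2 2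
  simp at e00 e01 e02 e11 e12 e22
  have expand : ∀ j k, ric j k = H 0 0 * R 0 j k 0 + H 0 1 * (R 0 j k 1 + R 1 j k 0)
      + H 0 2 * (R 0 j k 2 + R 2 j k 0) + H 1 1 * R 1 j k 1
      + H 1 2 * (R 1 j k 2 + R 2 j k 1) + H 2 2 * R 2 j k 2 := by
    intro j k
    rw [hric]
    simp only [Fin.sum_univ_three, hHsymm 1 0, hHsymm 2 0, hHsymm 2 1]
    ring
  have normalize : ∀ j k, ric j k * g.det = (g 1 1 * g 2 2 - g 1 2 * g 1 2) * R 0 j k 0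
      + (-(g 0 1 * g 2 2) + g 0 2 * g 1 2) * (R 0 j k 1 + R 1 j k 0)
      + (g 0 1 * g 1 2 - g 0 2 * g 1 1) * (R 0 j k 2 + R 2 j k 0)
      + (g 0 0 * g 2 2 - g 0 2 * g 0 2) * R 1 j k 1
      + (-(g 0 0 * g 1 2) + g 0 2 * g 0 1) * (R 1 j k 2 + R 2 j k 1)
      + (g 0 0 * g 1 1 - g 0 1 * g 0 1) * R 2 j k 2 := fun j k => by
    rw [expand, e00, e01, e02, e11, e12, e22]
    field_simp
  have r00 := normalize 0 0
  have r01 := normalize 0 1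
  have r02 := normalize 0 2
  have r11 := normalize 1 1
  have r12 := normalize 1 2
  have r22 := normalize 2 2
  have hscal : (∑ a, ∑ b, H a b * ric a b) = H 0 0 * ric 0 0 + 2 * (H 0 1 * ric 0 1)
      + 2 * (H 0 2 * ric 0 2) + H 1 1 * ric 1 1 + 2 * (H 1 2 * ric 1 2) + H 2 2 * ric 2 2 := by
    simp only [Fin.sum_univ_three, hHsymm 1 0, hHsymm 2 0, hHsymm 2 1, hricsymm 1 0,
      hricsymm 2 0, hricsymm 2 1]
    ring
  -- The symmetries leave six independent components: `R 0 1 0 1`, `R 0 1 0 2`, `R 0 1 1 2`, `R 0 2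
  -- 0 2`, `R 0 2 1 2` and `R 1 2 1 2`.
  simp only [hz1, hz2, h1 1 0, h1 2 0, h1 2 1, h2 _ _ 1 0, h2 _ _ 2 0, h2 _ _ 2 1,
    hp 0 2 0 1, hp 1 2 0 1, hp 1 2 0 2] at r00 r01 r02 r11 r12 r22
  have scal : (∑ a, ∑ b, H a b * ric a b) * g.det =
      -2 * (R 0 1 0 1 * g 2 2 + R 0 2 0 2 * g 1 1 + R 1 2 1 2 * g 0 0
        - 2 * R 0 1 0 2 * g 1 2 + 2 * R 0 1 1 2 * g 0 2 - 2 * R 0 2 1 2 * g 0 1) := by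
    refine mul_right_cancel₀ hd ?_
    rw [hscal, e00, e01, e02, e11, e12, e22]
    field_simp
    refine mul_right_cancel₀ hd ?_
    -- The coefficients are the entries of the adjugate. The double contraction is quadratic in
    -- them, and the 2×2 minors of the adjugate are, up to sign, `g.det` times entries of `g`; this
    -- is where `hdet` enters.
    linear_combination (g 1 1 * g 2 2 - g 1 2 ^ 2) * r00
      + 2 * (-(g 2 2 * g 0 1) + g 1 2 * g 0 2) * r01 + 2 * (g 1 2 * g 0 1 - g 1 1 * g 0 2) * r02
      + (g 2 2 * g 0 0 - g 0 2 ^ 2) * r11 + 2 * (-(g 1 2 * g 0 0) + g 0 1 * g 0 2) * r12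
      + (g 1 1 * g 0 0 - g 0 1 ^ 2) * r22
      + 2 * (R 0 1 0 1 * g 2 2 + R 0 2 0 2 * g 1 1 + R 1 2 1 2 * g 0 0
        - 2 * R 0 1 0 2 * g 1 2 + 2 * R 0 1 1 2 * g 0 2 - 2 * R 0 2 1 2 * g 0 1) * hdet
  have hPdet : ∀ j k, P j k * g.det = ric j k * g.det
      - (∑ a, ∑ b, H a b * ric a b) * g.det / 4 * g j k := fun j k => by rw [hP]; ring
  have p00 := hPdet 0 0
  have p01 := hPdet 0 1
  have p02 := hPdet 0 2
  have p11 := hPdet 1 1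
  have p12 := hPdet 1 2
  have p22 := hPdet 2 2
  rw [scal] at p00 p01 p02 p11 p12 p22
  rw [r00] at p00
  rw [r01] at p01
  rw [r02] at p02
  rw [r11] at p11
  rw [r12] at p12
  rw [r22] at p22
  have hPsymm : ∀ j k, P j k = P k j := fun j k => by rw [hP, hP, hricsymm j k, hg j k]
  -- Both sides are antisymmetric in `k, m` and in `i, j`, so only nine pairs of index pairs have to
  -- be checked.
  have reduce : ∀ i j k m, (R i j k m
      - (g i m * P j k - g j m * P i k + P i m * g j k - P j m * g i k)) * g.det = 0 := by
    intro i j k m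
    refine eq_zero_of_antisymm (T := fun k m => (R i j k m
      - (g i m * P j k - g j m * P i k + P i m * g j k - P j m * g i k)) * g.det)
      (fun k m => by simp only [h2 i j k m]; ring) ?_ ?_ ?_ k m
    · refine eq_zero_of_antisymm (T := fun i j => (R i j 0 1
        - (g i 1 * P j 0 - g j 1 * P i 0 + P i 1 * g j 0 - P j 1 * g i 0)) * g.det)
        (fun i j => by simp only [h1 i j]; ring) ?_ ?_ ?_ i j <;>
      try simp only [hg 1 0, hg 2 0, hg 2 1, hPsymm 1 0, hPsymm 2 0, hPsymm 2 1, hp 0 2 0 1,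
        hp 1 2 0 1, hp 1 2 0 2]
      · linear_combination R 0 1 0 1 * hdet
          - g 0 1 * p01 + g 1 1 * p00 - g 0 1 * p01 + g 0 0 * p11
      · linear_combination R 0 1 0 2 * hdet
          - g 0 1 * p02 + g 1 2 * p00 - g 0 2 * p01 + g 0 0 * p12
      · linear_combination R 0 1 1 2 * hdet
          - g 1 1 * p02 + g 1 2 * p01 - g 0 2 * p11 + g 0 1 * p12
    · refine eq_zero_of_antisymm (T := fun i j => (R i j 0 2
        - (g i 2 * P j 0 - g j 2 * P i 0 + P i 2 * g j 0 - P j 2 * g i 0)) * g.det)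
        (fun i j => by simp only [h1 i j]; ring) ?_ ?_ ?_ i j <;>
      try simp only [hg 1 0, hg 2 0, hg 2 1, hPsymm 1 0, hPsymm 2 0, hPsymm 2 1, hp 0 2 0 1,
        hp 1 2 0 1, hp 1 2 0 2]
      · linear_combination R 0 1 0 2 * hdet
          - g 0 2 * p01 + g 1 2 * p00 - g 0 1 * p02 + g 0 0 * p12
      · linear_combination R 0 2 0 2 * hdet
          - g 0 2 * p02 + g 2 2 * p00 - g 0 2 * p02 + g 0 0 * p22
      · linear_combination R 0 2 1 2 * hdet
          - g 1 2 * p02 + g 2 2 * p01 - g 0 2 * p12 + g 0 1 * p22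
    · refine eq_zero_of_antisymm (T := fun i j => (R i j 1 2
        - (g i 2 * P j 1 - g j 2 * P i 1 + P i 2 * g j 1 - P j 2 * g i 1)) * g.det)
        (fun i j => by simp only [h1 i j]; ring) ?_ ?_ ?_ i j <;>
      try simp only [hg 1 0, hg 2 0, hg 2 1, hPsymm 1 0, hPsymm 2 0, hPsymm 2 1, hp 0 2 0 1,
        hp 1 2 0 1, hp 1 2 0 2]
      · linear_combination R 0 1 1 2 * hdet
          - g 0 2 * p11 + g 1 2 * p01 - g 1 1 * p02 + g 0 1 * p12
      · linear_combination R 0 2 1 2 * hdet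
          - g 0 2 * p12 + g 2 2 * p01 - g 1 2 * p02 + g 0 1 * p22
      · linear_combination R 1 2 1 2 * hdet
          - g 1 2 * p12 + g 2 2 * p11 - g 1 2 * p12 + g 1 1 * p22
  exact sub_eq_zero.1 ((mul_eq_zero.1 (reduce i j k m)).resolve_right hd)

end Algebra

/-! ### Symmetries of the Riemann tensor and vanishing of the Weyl tensor. -/

namespace IsMetricOn

variable {G : E3 → Matrix (Fin 3) (Fin 3) ℝ} {U : Set E3} {y : E3}

theorem curvature_bianchi (hG : IsMetricOn G U) (hy : y ∈ U) (i j k l : Fin 3) :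
    curvature G i j k l y + curvature G j k i l y + curvature G k i j l y = 0 := by
  have h : ∀ a b c, pderiv a (christoffel G l b c) y = pderiv a (christoffel G l c b) y :=
    fun a b c => pderiv_congr_on hG.isOpen hy (fun z hz => hG.christoffel_symm hz l b c) a
  have h2 : ∀ m b c, christoffel G m b c y = christoffel G m c b y :=
    fun m b c => hG.christoffel_symm hy m b c
  simp only [curvature_eq]
  rw [h i k j, h j k i, h k i j]
  simp only [h2 _ k j, h2 _ k i, h2 _ j i]
  ring

/-- Metric compatibility, differentiated once more: `∂ᵢ∂ⱼ g(∂ₖ, ∂ₘ)` is symmetric in `i, j`, and its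
antisymmetrization is the part of the curvature symmetric in `k, m`. -/
theorem lower_curvature_antisymm (hG : IsMetricOn G U) (hy : y ∈ U) (i j k m : Fin 3) :
    ∑ l, curvature G i j k l y * G y l m = -∑ l, curvature G i j m l y * G y l k := by
  have hs : ∀ a b c, ContDiffAt ℝ ∞ (christoffel G a b c) y := hG.smooth_christoffel hy
  have hg : ∀ a b, ContDiffAt ℝ ∞ (fun z => G z a b) y := hG.smooth y hy
  have hB : ∀ b c d, ContDiffAt ℝ ∞ (fun z => ∑ l, christoffel G l b c z * G z l d) y :=
    fun b c d => ContDiffAt.sum fun l _ => (hs l b c).mul (hg l d)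
  have hcurv : ∀ k m, ∑ l, curvature G i j k l y * G y l m =
      (pderiv i (fun z => ∑ l, christoffel G l j k z * G z l m) y
        - ∑ a, christoffel G a i m y * ∑ l, christoffel G l j k y * G y l a)
      - (pderiv j (fun z => ∑ l, christoffel G l i k z * G z l m) y
        - ∑ a, christoffel G a j m y * ∑ l, christoffel G l i k y * G y l a) := by
    intro k m
    have h1 := hG.lower_covDeriv hy (Y := covDeriv G j (coordField k))
      (fun l => by rw [covDeriv_coordField]; exact hs l j k) i m
    have h2 := hG.lower_covDeriv hy (Y := covDeriv G i (coordField k))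
      (fun l => by rw [covDeriv_coordField]; exact hs l i k) j m
    simp only [covDeriv_coordField] at h1 h2
    rw [← h1, ← h2, ← Finset.sum_sub_distrib]
    refine Finset.sum_congr rfl fun l _ => ?_
    rw [curvature, sub_mul]
  have hmet : ∀ a b, pderiv a (pderiv b (fun z => G z k m)) y
      = pderiv a (fun z => ∑ l, christoffel G l b k z * G z l m) y
        + pderiv a (fun z => ∑ l, christoffel G l b m z * G z l k) y := by
    intro a b
    rw [← pderiv_add (hB b k m) (hB b m k)]
    refine pderiv_congr_on hG.isOpen hy (fun z hz => ?_) a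
    rw [hG.pderiv_metric hz]
    simp only [hG.symm z hz k]
  have hcomm := pderiv_comm (hg k m) i j
  rw [hmet, hmet] at hcomm
  rw [hcurv, hcurv]
  -- Both double sums are `g(∇ᵢ∂_b, ∇ⱼ∂_c)`, so the quadratic terms of the two curvatures cancel.
  have e : ∀ b c, ∑ a, christoffel G a i b y * ∑ l, christoffel G l j c y * G y l a
      = ∑ a, christoffel G a j c y * ∑ l, christoffel G l i b y * G y l a := by
    intro b c
    simp only [Finset.mul_sum]
    rw [Finset.sum_comm]
    refine Finset.sum_congr rfl fun a _ => Finset.sum_congr rfl fun l _ => ?_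
    rw [hG.symm y hy a l]; ring
  rw [e m k, e k m]
  linarith

theorem raise_lower (hG : IsMetricOn G U) (hy : y ∈ U) (v : Fin 3 → ℝ) (l : Fin 3) :
    ∑ m, (G y)⁻¹ l m * ∑ a, v a * G y a m = v l := by
  simp only [Finset.mul_sum]
  rw [Finset.sum_comm]
  have : ∀ a, ∑ m, (G y)⁻¹ l m * (v a * G y a m) = v a * if l = a then 1 else 0 := by
    intro a
    rw [← hG.sum_inv_mul hy l a, Finset.mul_sum]
    refine Finset.sum_congr rfl fun m _ => ?_
    rw [hG.symm y hy a m]; ring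
  simp [this]

theorem lower_curvature_antisymm_left (i j k m : Fin 3) :
    ∑ l, curvature G i j k l y * G y l m = -∑ l, curvature G j i k l y * G y l m := by
  simp only [curvature_antisymm G i j, neg_mul, Finset.sum_neg_distrib]

theorem lower_curvature_bianchi (hG : IsMetricOn G U) (hy : y ∈ U) (i j k m : Fin 3) :
    ∑ l, curvature G i j k l y * G y l m + ∑ l, curvature G j k i l y * G y l m
      + ∑ l, curvature G k i j l y * G y l m = 0 := by
  simp only [← Finset.sum_add_distrib, ← add_mul, hG.curvature_bianchi hy, zero_mul,
    Finset.sum_const_zero]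

theorem ricci_eq_contraction (hG : IsMetricOn G U) (hy : y ∈ U) (j k : Fin 3) :
    ricci G j k y = ∑ i, ∑ m, (G y)⁻¹ i m * ∑ l, curvature G i j k l y * G y l m := by
  simp only [hG.raise_lower hy (fun l => curvature G _ j k l y), ricci]

theorem schouten_symm (hG : IsMetricOn G U) (hy : y ∈ U) (j k : Fin 3) :
    schouten G j k y = schouten G k j y := by
  have h := contraction_symm_of_bianchi
    (R := fun i j k m => ∑ l, curvature G i j k l y * G y l m) (hG.inv_symm hy)
    lower_curvature_antisymm_left (hG.lower_curvature_antisymm hy)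
    (hG.lower_curvature_bianchi hy) j k
  rw [schouten, schouten, hG.symm y hy j k, hG.ricci_eq_contraction hy, h,
    ← hG.ricci_eq_contraction hy]

/-- In dimension three the Weyl tensor vanishes. -/
theorem lower_curvature_eq (hG : IsMetricOn G U) (hy : y ∈ U) (i j k m : Fin 3) :
    ∑ l, curvature G i j k l y * G y l m =
      G y i m * schouten G j k y - G y j m * schouten G i k y
        + schouten G i m y * G y j k - schouten G j m y * G y i k :=
  curvatureTensor_eq_of_dim_three (R := fun i j k m => ∑ l, curvature G i j k l y * G y l m)
    (ric := fun j k => ricci G j k y) (P := fun j k => schouten G j k y)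
    (hG.symm y hy) (hG.det_ne_zero y hy) rfl lower_curvature_antisymm_left
    (hG.lower_curvature_antisymm hy) (hG.lower_curvature_bianchi hy)
    (hG.ricci_eq_contraction hy) (fun _ _ => rfl) i j k m

end IsMetricOn

/-! ### Conformal change of the connection, the curvature and the Schouten tensor. -/

/-- The components of the gradient of `φ`. -/
def gradient (G : E3 → Matrix (Fin 3) (Fin 3) ℝ) (φ : E3 → ℝ) (l : Fin 3) (y : E3) : ℝ :=
  ∑ m, (G y)⁻¹ l m * pderiv m φ y

/-- The squared norm of the gradient of `φ`. -/
def gradientSq (G : E3 → Matrix (Fin 3) (Fin 3) ℝ) (φ : E3 → ℝ) (y : E3) : ℝ :=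
  ∑ m, gradient G φ m y * pderiv m φ y

/-- The Hessian `∇dφ(∂ⱼ, ∂ₖ)`. -/
def hessian (G : E3 → Matrix (Fin 3) (Fin 3) ℝ) (φ : E3 → ℝ) (j k : Fin 3) (y : E3) : ℝ :=
  pderiv j (pderiv k φ) y - ∑ m, christoffel G m j k y * pderiv m φ y

/-- The difference `-∇dφ + dφ ⊗ dφ - ½ |dφ|² g` of the Schouten tensors of `e^{2φ} g` and `g`. -/
def schoutenVariation (G : E3 → Matrix (Fin 3) (Fin 3) ℝ) (φ : E3 → ℝ) (j k : Fin 3)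
    (y : E3) : ℝ :=
  -hessian G φ j k y + pderiv j φ y * pderiv k φ y - 1 / 2 * gradientSq G φ y * G y j k

/-- The matrix of coefficients of the metric `e^{2φ} g`. -/
def expScale (φ : E3 → ℝ) (G : E3 → Matrix (Fin 3) (Fin 3) ℝ) (y : E3) :
    Matrix (Fin 3) (Fin 3) ℝ :=
  Real.exp (2 * φ y) • G y

/-- A product of two Christoffel symbols of a conformally changed metric. -/
theorem sum_conformal_christoffel_mul (a b c p v : Fin 3 → ℝ) (d q e w : ℝ) (j k l : Fin 3) :
    ∑ m, (a m + (d * p m + (1 : Matrix (Fin 3) (Fin 3) ℝ) l m * q - c m * w))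
        * (b m + ((1 : Matrix (Fin 3) (Fin 3) ℝ) m j * p k
          + (1 : Matrix (Fin 3) (Fin 3) ℝ) m k * p j - e * v m))
      = ∑ m, a m * b m + a j * p k + a k * p j - e * ∑ m, a m * v m
        + d * (∑ m, b m * p m + 2 * (p j * p k) - e * ∑ m, v m * p m)
        + q * (b l + (1 : Matrix (Fin 3) (Fin 3) ℝ) l j * p k
          + (1 : Matrix (Fin 3) (Fin 3) ℝ) l k * p j - e * v l)
        - w * (∑ m, b m * c m + c j * p k + c k * p j - e * ∑ m, v m * c m) := by
  have h1 : ∀ (F : Fin 3 → ℝ) (i : Fin 3),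
      ∑ m, F m * (1 : Matrix (Fin 3) (Fin 3) ℝ) m i = F i := fun F i => by
    simp [Matrix.one_apply]
  have h2 : ∀ (F : Fin 3 → ℝ) (i : Fin 3),
      ∑ m, F m * (1 : Matrix (Fin 3) (Fin 3) ℝ) i m = F i := fun F i => by
    simp [Matrix.one_apply]
  have ha := h1 a j
  have hb := h1 a k
  have hc := h1 c j
  have hd := h1 c k
  have he := h1 p j
  have hf := h1 p k
  have hg := h2 b l
  have hh := h2 v l
  have hi := h2 (fun m => (1 : Matrix (Fin 3) (Fin 3) ℝ) m j) l
  have hj := h2 (fun m => (1 : Matrix (Fin 3) (Fin 3) ℝ) m k) l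
  simp only [Fin.sum_univ_three] at *
  linear_combination p k * ha + p j * hb - w * p k * hc - w * p j * hd + d * p k * he
    + d * p j * hf + q * hg - q * e * hh + q * p k * hi + q * p j * hj

/-- Contraction of the changed symbols with a covector `t`: here `a` stands for `Γᵐᵢₖ`, `q` and `r`
for `∂ᵢφ` and `∂ₖφ`, `e` for `gᵢₖ` and `v` for the gradient. -/
theorem sum_conformal_christoffel_mul_apply (a v t : Fin 3 → ℝ) (q r e : ℝ) (i k : Fin 3) :
    ∑ m, (a m + ((1 : Matrix (Fin 3) (Fin 3) ℝ) m i * r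
          + (1 : Matrix (Fin 3) (Fin 3) ℝ) m k * q - e * v m)) * t m
      = ∑ m, a m * t m + r * t i + q * t k - e * ∑ m, v m * t m := by
  have h1 : ∀ i : Fin 3, ∑ m, t m * (1 : Matrix (Fin 3) (Fin 3) ℝ) m i = t i := fun i => by
    simp [Matrix.one_apply]
  have ha := h1 i
  have hb := h1 k
  simp only [Fin.sum_univ_three] at *
  linear_combination r * ha + q * hb

theorem expScale_apply (φ : E3 → ℝ) (G : E3 → Matrix (Fin 3) (Fin 3) ℝ) (y : E3) (i j : Fin 3) :
    expScale φ G y i j = Real.exp (2 * φ y) * G y i j :=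
  rfl

namespace IsMetricOn

variable {G : E3 → Matrix (Fin 3) (Fin 3) ℝ} {U : Set E3} {y : E3} {φ : E3 → ℝ}

theorem scale (hG : IsMetricOn G U) (hφ : ∀ y ∈ U, ContDiffAt ℝ ∞ φ y) :
    IsMetricOn (expScale φ G) U where
  isOpen := hG.isOpen
  smooth y hy i j := by
    simp only [expScale, Matrix.smul_apply, smul_eq_mul]
    exact (Real.contDiff_exp.contDiffAt.comp y (contDiffAt_const.mul (hφ y hy))).mul
      (hG.smooth y hy i j)
  symm y hy i j := by
    simp only [expScale, Matrix.smul_apply, hG.symm y hy i j]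
  det_ne_zero y hy := by
    rw [expScale, Matrix.det_smul]
    exact mul_ne_zero (pow_ne_zero _ (Real.exp_ne_zero _)) (hG.det_ne_zero y hy)

theorem pderiv_expScale (hG : IsMetricOn G U) (hφ : ContDiffAt ℝ ∞ φ y) (hy : y ∈ U)
    (i j k : Fin 3) :
    pderiv i (fun z => expScale φ G z j k) y
      = Real.exp (2 * φ y) * (2 * pderiv i φ y * G y j k + pderiv i (fun z => G z j k) y) := by
  simp only [expScale, Matrix.smul_apply, smul_eq_mul]
  have h2 : ContDiffAt ℝ ∞ (fun z => 2 * φ z) y := contDiffAt_const.mul hφ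
  rw [pderiv_mul (φ := fun z => Real.exp (2 * φ z)) (Real.contDiff_exp.contDiffAt.comp y h2)
    (hG.smooth y hy j k), pderiv_exp h2, pderiv_const_mul 2 hφ]
  ring

theorem lower_gradient (hG : IsMetricOn G U) (hy : y ∈ U) (k : Fin 3) :
    ∑ l, gradient G φ l y * G y l k = pderiv k φ y :=
  hG.lower_raise hy (fun m => pderiv m φ y) k

/-- With the upper index lowered by `G`, both sides are given by the Koszul formula, and the common
factor `e^{2φ}` cancels; nondegeneracy raises the index again. -/
theorem christoffel_expScale (hG : IsMetricOn G U) (hφ : ∀ y ∈ U, ContDiffAt ℝ ∞ φ y)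
    (hy : y ∈ U) (l i j : Fin 3) :
    christoffel (expScale φ G) l i j y = christoffel G l i j y
      + ((1 : Matrix (Fin 3) (Fin 3) ℝ) l i * pderiv j φ y
        + (1 : Matrix (Fin 3) (Fin 3) ℝ) l j * pderiv i φ y - G y i j * gradient G φ l y) := by
  refine hG.eq_of_lower_eq hy (v := fun l => christoffel (expScale φ G) l i j y)
    (w := fun l => christoffel G l i j y
      + ((1 : Matrix (Fin 3) (Fin 3) ℝ) l i * pderiv j φ y
        + (1 : Matrix (Fin 3) (Fin 3) ℝ) l j * pderiv i φ y - G y i j * gradient G φ l y))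
    (fun k => ?_) l
  rw [sum_conformal_christoffel_mul_apply _ _ (fun l => G y l k), hG.lower_christoffel hy,
    hG.lower_gradient hy]
  have h := (hG.scale hφ).lower_christoffel hy i j k
  rw [hG.pderiv_expScale (hφ y hy) hy, hG.pderiv_expScale (hφ y hy) hy,
    hG.pderiv_expScale (hφ y hy) hy] at h
  simp only [expScale_apply, mul_left_comm _ (Real.exp _)] at h
  rw [← Finset.mul_sum] at h
  refine mul_left_cancel₀ (Real.exp_ne_zero (2 * φ y)) ?_
  rw [h]; ring

theorem smooth_gradient (hG : IsMetricOn G U) (hφ : ContDiffAt ℝ ∞ φ y) (hy : y ∈ U)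
    (l : Fin 3) : ContDiffAt ℝ ∞ (gradient G φ l) y :=
  ContDiffAt.sum fun m _ => (hG.smooth_inv hy l m).mul (contDiffAt_pderiv hφ m)

theorem smooth_gradientSq (hG : IsMetricOn G U) (hφ : ContDiffAt ℝ ∞ φ y) (hy : y ∈ U) :
    ContDiffAt ℝ ∞ (gradientSq G φ) y :=
  ContDiffAt.sum fun m _ => (hG.smooth_gradient hφ hy m).mul (contDiffAt_pderiv hφ m)

theorem smooth_hessian (hG : IsMetricOn G U) (hφ : ContDiffAt ℝ ∞ φ y) (hy : y ∈ U)
    (j k : Fin 3) : ContDiffAt ℝ ∞ (hessian G φ j k) y :=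
  (contDiffAt_pderiv (contDiffAt_pderiv hφ k) j).sub
    (ContDiffAt.sum fun m _ => (hG.smooth_christoffel hy m j k).mul (contDiffAt_pderiv hφ m))

theorem hessian_symm (hG : IsMetricOn G U) (hφ : ContDiffAt ℝ ∞ φ y) (hy : y ∈ U)
    (j k : Fin 3) : hessian G φ j k y = hessian G φ k j y := by
  simp only [hessian, pderiv_comm hφ j k, hG.christoffel_symm hy _ j k]

/-- The covariant derivative of the gradient is the Hessian with one index raised. -/
theorem pderiv_gradient (hG : IsMetricOn G U) (hφ : ∀ y ∈ U, ContDiffAt ℝ ∞ φ y) (hy : y ∈ U)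
    (i l : Fin 3) :
    pderiv i (gradient G φ l) y = ∑ m, (G y)⁻¹ l m * hessian G φ i m y
      - ∑ m, christoffel G l i m y * gradient G φ m y := by
  rw [eq_sub_iff_add_eq]
  refine hG.eq_of_lower_eq hy (v := fun l => covDeriv G i (gradient G φ) l y)
    (w := fun l => ∑ m, (G y)⁻¹ l m * hessian G φ i m y) (fun k => ?_) l
  rw [hG.lower_raise hy, hG.lower_covDeriv hy (hG.smooth_gradient (hφ y hy) hy)]
  simp only [hG.lower_gradient hy]
  rw [pderiv_congr_on hG.isOpen hy (fun z hz => hG.lower_gradient hz k), hessian]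

/-- The Christoffel terms from differentiating the gradient and the differential cancel, and the two
Hessian contributions coincide because the inverse metric is symmetric. -/
theorem pderiv_gradientSq (hG : IsMetricOn G U) (hφ : ∀ y ∈ U, ContDiffAt ℝ ∞ φ y) (hy : y ∈ U)
    (i : Fin 3) :
    pderiv i (gradientSq G φ) y = 2 * ∑ m, gradient G φ m y * hessian G φ i m y := by
  have hg := hG.smooth_gradient (hφ y hy) hy
  have hp := fun m => contDiffAt_pderiv (hφ y hy) m
  have h1 : ∀ m, gradient G φ m y * pderiv i (pderiv m φ) y = gradient G φ m y * hessian G φ i m y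
      + ∑ a, christoffel G a i m y * gradient G φ m y * pderiv a φ y := by
    intro m
    simp only [hessian, Fin.sum_univ_three]; ring
  have h2 : ∑ m, (∑ a, (G y)⁻¹ m a * hessian G φ i a y) * pderiv m φ y
      = ∑ m, gradient G φ m y * hessian G φ i m y := by
    simp only [gradient, Finset.sum_mul]
    rw [Finset.sum_comm]
    refine Finset.sum_congr rfl fun a _ => Finset.sum_congr rfl fun m _ => ?_
    rw [hG.inv_symm hy]; ring
  have h3 : pderiv i (gradientSq G φ) y = ∑ m, (pderiv i (gradient G φ m) y * pderiv m φ y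
      + gradient G φ m y * pderiv i (pderiv m φ) y) := by
    unfold gradientSq
    rw [pderiv_sum fun m => (hg m).mul (hp m)]
    exact Finset.sum_congr rfl fun m _ => pderiv_mul (hg m) (hp m) i
  rw [h3]
  simp only [h1, hG.pderiv_gradient hφ hy, sub_mul, Finset.sum_add_distrib,
    Finset.sum_sub_distrib, h2]
  simp only [Fin.sum_univ_three]
  ring

theorem pderiv_christoffel_expScale (hG : IsMetricOn G U) (hφ : ∀ y ∈ U, ContDiffAt ℝ ∞ φ y)
    (hy : y ∈ U) (i j k l : Fin 3) :
    pderiv i (christoffel (expScale φ G) l j k) y = pderiv i (christoffel G l j k) y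
      + ((1 : Matrix (Fin 3) (Fin 3) ℝ) l j * pderiv i (pderiv k φ) y
        + (1 : Matrix (Fin 3) (Fin 3) ℝ) l k * pderiv i (pderiv j φ) y
        - (pderiv i (fun z => G z j k) y * gradient G φ l y
          + G y j k * pderiv i (gradient G φ l) y)) := by
  have hp := fun m => contDiffAt_pderiv (hφ y hy) m
  have hv := hG.smooth_gradient (hφ y hy) hy l
  have hg := hG.smooth y hy j k
  have h1 : ContDiffAt ℝ ∞ (fun z => (1 : Matrix (Fin 3) (Fin 3) ℝ) l j * pderiv k φ z) y :=
    contDiffAt_const.mul (hp k)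
  have h2 : ContDiffAt ℝ ∞ (fun z => (1 : Matrix (Fin 3) (Fin 3) ℝ) l k * pderiv j φ z) y :=
    contDiffAt_const.mul (hp j)
  rw [pderiv_congr_on hG.isOpen hy (fun z hz => hG.christoffel_expScale hφ hz l j k),
    pderiv_add (hG.smooth_christoffel hy l j k) ((h1.add h2).sub (hg.mul hv)),
    pderiv_sub (h1.add h2) (hg.mul hv), pderiv_add h1 h2, pderiv_const_mul _ (hp k),
    pderiv_const_mul _ (hp j), pderiv_mul hg hv]

/-- If `A` is the change of connection, the curvature changes by `d^∇ A` plus the commutator of `A`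
with itself. The first supplies the Hessian of `φ`, the second `dφ ⊗ dφ - ½ |dφ|² g`, and together
they form `schoutenVariation`. -/
theorem curvature_expScale (hG : IsMetricOn G U) (hφ : ∀ y ∈ U, ContDiffAt ℝ ∞ φ y)
    (hy : y ∈ U) (i j k l : Fin 3) :
    curvature (expScale φ G) i j k l y = curvature G i j k l y
      + ((1 : Matrix (Fin 3) (Fin 3) ℝ) l i * schoutenVariation G φ j k y
        - (1 : Matrix (Fin 3) (Fin 3) ℝ) l j * schoutenVariation G φ i k y
        + (∑ m, (G y)⁻¹ l m * schoutenVariation G φ i m y) * G y j k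
        - (∑ m, (G y)⁻¹ l m * schoutenVariation G φ j m y) * G y i k) := by
  have hraise : ∀ a, ∑ m, (G y)⁻¹ l m * schoutenVariation G φ a m y
      = -(∑ m, (G y)⁻¹ l m * hessian G φ a m y) + pderiv a φ y * gradient G φ l y
        - 1 / 2 * gradientSq G φ y * (1 : Matrix (Fin 3) (Fin 3) ℝ) l a := by
    intro a
    have h := hG.sum_inv_mul hy l a
    rw [← Matrix.one_apply] at h
    simp only [schoutenVariation, gradient, hG.symm y hy a]
    simp only [Fin.sum_univ_three] at h ⊢
    linear_combination (-1 / 2 * gradientSq G φ y) * h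
  have hvg : ∀ a, ∑ m, gradient G φ m y * G y a m = pderiv a φ y := by
    intro a
    simp only [hG.symm y hy a, hG.lower_gradient hy]
  have hpp : ∀ a b, pderiv a (pderiv b φ) y
      = hessian G φ a b y + ∑ m, christoffel G m a b y * pderiv m φ y := by
    intro a b
    rw [hessian]; ring
  have hΓ := hG.christoffel_symm hy
  have hh := hG.hessian_symm (hφ y hy) hy i j
  have hgs := hG.symm y hy i j
  simp only [curvature_eq, hG.pderiv_christoffel_expScale hφ hy, hG.christoffel_expScale hφ hy,
    sum_conformal_christoffel_mul, hraise, hvg, hpp, hG.pderiv_metric hy,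
    hG.pderiv_gradient hφ hy]
  -- The products of Christoffel symbols leave the contraction of the gradient with `dφ`, which is
  -- folded into `|dφ|²`.
  rw [← gradientSq]
  simp only [schoutenVariation]
  simp only [hΓ _ j i, hh, hgs]
  ring

theorem smooth_curvature (hG : IsMetricOn G U) (hy : y ∈ U) (i j k l : Fin 3) :
    ContDiffAt ℝ ∞ (curvature G i j k l) y := by
  have h := hG.smooth_christoffel hy
  rw [show curvature G i j k l = _ from funext (curvature_eq G i j k l)]
  exact ((contDiffAt_pderiv (h l j k) i).add
    (ContDiffAt.sum fun m _ => (h l i m).mul (h m j k))).sub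
    ((contDiffAt_pderiv (h l i k) j).add (ContDiffAt.sum fun m _ => (h l j m).mul (h m i k)))

theorem smooth_ricci (hG : IsMetricOn G U) (hy : y ∈ U) (j k : Fin 3) :
    ContDiffAt ℝ ∞ (ricci G j k) y :=
  ContDiffAt.sum fun i _ => hG.smooth_curvature hy i j k i

theorem smooth_schouten (hG : IsMetricOn G U) (hy : y ∈ U) (j k : Fin 3) :
    ContDiffAt ℝ ∞ (schouten G j k) y :=
  (hG.smooth_ricci hy j k).sub (((ContDiffAt.sum fun a _ => ContDiffAt.sum fun b _ =>
    (hG.smooth_inv hy a b).mul (hG.smooth_ricci hy a b)).div_const 4).mul (hG.smooth y hy j k))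

theorem smooth_schoutenField (hG : IsMetricOn G U) (hy : y ∈ U) (j l : Fin 3) :
    ContDiffAt ℝ ∞ (schoutenField G j l) y :=
  ContDiffAt.sum fun k _ => (hG.smooth_inv hy l k).mul (hG.smooth_schouten hy j k)

theorem smooth_schoutenVariation (hG : IsMetricOn G U) (hφ : ContDiffAt ℝ ∞ φ y) (hy : y ∈ U)
    (j k : Fin 3) : ContDiffAt ℝ ∞ (schoutenVariation G φ j k) y :=
  ((hG.smooth_hessian hφ hy j k).neg.add
    ((contDiffAt_pderiv hφ j).mul (contDiffAt_pderiv hφ k))).sub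
    ((contDiffAt_const.mul (hG.smooth_gradientSq hφ hy)).mul (hG.smooth y hy j k))

theorem inv_expScale (hG : IsMetricOn G U) (hy : y ∈ U) (i j : Fin 3) :
    (expScale φ G y)⁻¹ i j = (Real.exp (2 * φ y))⁻¹ * (G y)⁻¹ i j := by
  have h := Matrix.inv_smul' (A := G y) (Units.mk0 _ (Real.exp_ne_zero (2 * φ y)))
    (isUnit_iff_ne_zero.2 (hG.det_ne_zero y hy))
  have h2 := congrFun (congrFun h i) j
  -- A unit acts through its value and its inverse through the inverse value, by definition.
  exact h2

/-- In the trace the terms in `Q` alone count `3 - 1 - 1 = 1`, the `3` being the dimension. -/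
theorem ricci_expScale (hG : IsMetricOn G U) (hφ : ∀ y ∈ U, ContDiffAt ℝ ∞ φ y)
    (hy : y ∈ U) (j k : Fin 3) :
    ricci (expScale φ G) j k y = ricci G j k y + schoutenVariation G φ j k y
      + (∑ a, ∑ b, (G y)⁻¹ a b * schoutenVariation G φ a b y) * G y j k := by
  have h1 : ∑ i, (1 : Matrix (Fin 3) (Fin 3) ℝ) i i = 3 := by simp
  have h2 : ∑ i, (1 : Matrix (Fin 3) (Fin 3) ℝ) i j * schoutenVariation G φ i k y
      = schoutenVariation G φ j k y := by simp [Matrix.one_apply]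
  have h3 := hG.lower_raise hy (fun m => schoutenVariation G φ j m y) k
  simp only [ricci, hG.curvature_expScale hφ hy, Finset.sum_add_distrib, Finset.sum_sub_distrib,
    ← Finset.sum_mul, h1, h2, h3]
  ring

/-- The trace of `Q` enters `Ric` as `(tr Q) g` and `scal` as `4 tr Q`, up to the factor `e^{-2φ}`
that `e^{2φ} g` absorbs; the `1/4` in the Schouten tensor removes it. -/
theorem schouten_expScale (hG : IsMetricOn G U) (hφ : ∀ y ∈ U, ContDiffAt ℝ ∞ φ y)
    (hy : y ∈ U) (j k : Fin 3) :
    schouten (expScale φ G) j k y = schouten G j k y + schoutenVariation G φ j k y := by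
  have htr : ∑ a, ∑ b, (G y)⁻¹ a b * G y a b = 3 := by
    have h : ∀ a, ∑ b, (G y)⁻¹ a b * G y a b = 1 := fun a => by
      have := hG.sum_inv_mul hy a a
      simp only [hG.symm y hy a]
      simpa using this
    simp [h]
  have hscal : scalarCurvature (expScale φ G) y = (Real.exp (2 * φ y))⁻¹ *
      (scalarCurvature G y + 4 * ∑ a, ∑ b, (G y)⁻¹ a b * schoutenVariation G φ a b y) := by
    set τ := ∑ a, ∑ b, (G y)⁻¹ a b * schoutenVariation G φ a b y with hτ
    have h : ∀ a b, (expScale φ G y)⁻¹ a b * ricci (expScale φ G) a b y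
        = (Real.exp (2 * φ y))⁻¹ * ((G y)⁻¹ a b * ricci G a b y
          + (G y)⁻¹ a b * schoutenVariation G φ a b y + τ * ((G y)⁻¹ a b * G y a b)) := by
      intro a b
      rw [hG.inv_expScale hy, hG.ricci_expScale hφ hy]; ring
    simp only [scalarCurvature, h, ← Finset.mul_sum, Finset.sum_add_distrib, ← hτ, htr]
    ring
  have he := Real.exp_ne_zero (2 * φ y)
  rw [schouten, hscal, hG.ricci_expScale hφ hy, expScale_apply, schouten]
  field_simp
  ring

/-! ### The Cotton form and its conformal invariance in coordinates. -/

/-- The Cotton form is the antisymmetrized covariant derivative of the Schouten tensor. -/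
theorem cottonComponent_eq (hG : IsMetricOn G U) (hy : y ∈ U) (i j k : Fin 3) :
    cottonComponent G i j k y =
      (pderiv i (schouten G j k) y - ∑ m, christoffel G m i k y * schouten G j m y)
      - (pderiv j (schouten G i k) y - ∑ m, christoffel G m j k y * schouten G i m y) := by
  have h : ∀ i j, ∑ l, covDeriv G i (schoutenField G j) l y * G y l k
      = pderiv i (schouten G j k) y - ∑ m, christoffel G m i k y * schouten G j m y := by
    intro i j
    have hl : ∀ z ∈ U, ∀ k, ∑ l, schoutenField G j l z * G z l k = schouten G j k z :=
      fun z hz k => hG.lower_raise hz (fun k => schouten G j k z) k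
    rw [hG.lower_covDeriv hy (hG.smooth_schoutenField hy j),
      pderiv_congr_on hG.isOpen hy (fun z hz => hl z hz k)]
    simp only [hl y hy]
  rw [← h, ← h, ← Finset.sum_sub_distrib, cottonComponent]
  refine Finset.sum_congr rfl fun l _ => ?_
  rw [extCovDeriv, sub_mul]

/-- The Ricci identity for the differential of a function. -/
theorem ricci_identity (hG : IsMetricOn G U) (hφ : ContDiffAt ℝ ∞ φ y) (hy : y ∈ U)
    (i j k : Fin 3) :
    (pderiv i (hessian G φ j k) y - ∑ m, christoffel G m i k y * hessian G φ j m y)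
      - (pderiv j (hessian G φ i k) y - ∑ m, christoffel G m j k y * hessian G φ i m y)
      = -∑ m, curvature G i j k m y * pderiv m φ y := by
  have hp := fun m => contDiffAt_pderiv hφ m
  have hΓ := hG.smooth_christoffel hy
  have h : ∀ i j, pderiv i (hessian G φ j k) y = pderiv i (pderiv j (pderiv k φ)) y
      - ∑ m, (pderiv i (christoffel G m j k) y * pderiv m φ y
        + christoffel G m j k y * pderiv i (pderiv m φ) y) := by
    intro i j
    unfold hessian
    rw [pderiv_sub (contDiffAt_pderiv (hp k) j) (ContDiffAt.sum fun m _ => (hΓ m j k).mul (hp m)),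
      pderiv_sum fun m => (hΓ m j k).mul (hp m)]
    simp only [pderiv_mul (hΓ _ j k) (hp _)]
  rw [h i j, h j i, pderiv_comm (hp k) i j]
  simp only [curvature_eq, hessian, Fin.sum_univ_three]
  ring

/-- The value of `R(∂ᵢ, ∂ⱼ)∂ₖ` on the gradient, in dimension three. -/
theorem sum_curvature_mul_pderiv (hG : IsMetricOn G U) (hy : y ∈ U) (i j k : Fin 3) :
    ∑ m, curvature G i j k m y * pderiv m φ y =
      pderiv i φ y * schouten G j k y - pderiv j φ y * schouten G i k y
        + (∑ m, gradient G φ m y * schouten G i m y) * G y j k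
        - (∑ m, gradient G φ m y * schouten G j m y) * G y i k := by
  have h : ∑ m, curvature G i j k m y * pderiv m φ y
      = ∑ m, gradient G φ m y * ∑ l, curvature G i j k l y * G y l m := by
    simp only [Finset.mul_sum]
    rw [Finset.sum_comm]
    refine Finset.sum_congr rfl fun l _ => ?_
    rw [← hG.lower_gradient hy l, Finset.mul_sum]
    refine Finset.sum_congr rfl fun m _ => ?_
    rw [hG.symm y hy l m]; ring
  rw [h, ← hG.lower_gradient hy i, ← hG.lower_gradient hy j]
  simp only [hG.lower_curvature_eq hy, hG.symm y hy _ i, hG.symm y hy _ j, Fin.sum_univ_three]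
  ring

theorem cottonComponent_expScale (hG : IsMetricOn G U) (hφ : ∀ y ∈ U, ContDiffAt ℝ ∞ φ y)
    (hy : y ∈ U) (i j k : Fin 3) :
    cottonComponent (expScale φ G) i j k y = cottonComponent G i j k y := by
  have hφy := hφ y hy
  have hp := fun m => contDiffAt_pderiv hφy m
  have hs := hG.smooth_gradientSq hφy hy
  -- The index `k` stays fixed; only the pair to be antisymmetrized varies.
  have hQ : ∀ i j, pderiv i (schoutenVariation G φ j k) y = -pderiv i (hessian G φ j k) y
      + (pderiv i (pderiv j φ) y * pderiv k φ y + pderiv j φ y * pderiv i (pderiv k φ) y)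
      - 1 / 2 * (pderiv i (gradientSq G φ) y * G y j k
        + gradientSq G φ y * pderiv i (fun z => G z j k) y) := by
    intro i j
    have h1 := hG.smooth_hessian hφy hy j k
    have h2 : ContDiffAt ℝ ∞ (fun z => pderiv j φ z * pderiv k φ z) y := (hp j).mul (hp k)
    have h3 := hG.smooth y hy j k
    have h4 : ContDiffAt ℝ ∞ (fun z => -1 * hessian G φ j k z) y := contDiffAt_const.mul h1
    have h5 : ContDiffAt ℝ ∞ (fun z => 1 / 2 * gradientSq G φ z) y := contDiffAt_const.mul hs
    have he : schoutenVariation G φ j k = fun z => -1 * hessian G φ j k z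
        + pderiv j φ z * pderiv k φ z - 1 / 2 * gradientSq G φ z * G z j k := by
      funext z
      rw [schoutenVariation]; ring
    rw [he, pderiv_sub (h4.add h2) (h5.mul h3), pderiv_add h4 h2, pderiv_const_mul _ h1,
      pderiv_mul (hp j) (hp k), pderiv_mul h5 h3, pderiv_const_mul _ hs]
    ring
  have hP : ∀ i j, pderiv i (schouten (expScale φ G) j k) y
      = pderiv i (schouten G j k) y + pderiv i (schoutenVariation G φ j k) y := by
    intro i j
    rw [pderiv_congr_on hG.isOpen hy (fun z hz => hG.schouten_expScale hφ hz j k),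
      pderiv_add (hG.smooth_schouten hy j k) (hG.smooth_schoutenVariation hφy hy j k)]
  have hv : ∀ a, ∑ m, gradient G φ m y * G y a m = pderiv a φ y := by
    intro a
    simp only [hG.symm y hy a, hG.lower_gradient hy]
  have hpp : ∀ a b, pderiv a (pderiv b φ) y
      = hessian G φ a b y + ∑ m, christoffel G m a b y * pderiv m φ y := by
    intro a b
    rw [hessian]; ring
  have hvQ : ∀ a, ∑ m, gradient G φ m y * schoutenVariation G φ a m y
      = -∑ m, gradient G φ m y * hessian G φ a m y + 1 / 2 * gradientSq G φ y * pderiv a φ y := by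
    intro a
    have h := hv a
    simp only [schoutenVariation, gradientSq, Fin.sum_univ_three] at h ⊢
    linear_combination (-1 / 2 * (gradient G φ 0 y * pderiv 0 φ y
      + gradient G φ 1 y * pderiv 1 φ y + gradient G φ 2 y * pderiv 2 φ y)) * h
  have hΓQ : ∀ a b c, ∑ m, christoffel G m a b y * schoutenVariation G φ c m y
      = -∑ m, christoffel G m a b y * hessian G φ c m y
        + pderiv c φ y * ∑ m, christoffel G m a b y * pderiv m φ y
        - 1 / 2 * gradientSq G φ y * ∑ m, christoffel G m a b y * G y c m := by
    intro a b c
    simp only [schoutenVariation, Fin.sum_univ_three]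
    ring
  -- Ricci identity with the curvature expressed by the Schouten tensor: the only point where
  -- dimension three enters the cancellation, apart from the form of `schouten_expScale`.
  have hR := hG.ricci_identity hφy hy i j k
  rw [hG.sum_curvature_mul_pderiv hy] at hR
  have hΓs := hG.christoffel_symm hy
  have hh := hG.hessian_symm hφy hy j i
  have hgs := hG.symm y hy j i
  have hPs : schouten G j i y = schouten G i j y := hG.schouten_symm hy j i
  -- Each form is lowered with its own metric, so only the symbols `Γ` and `Sch` of that metric
  -- occur and no exponential factor appears.
  rw [(hG.scale hφ).cottonComponent_eq hy, hG.cottonComponent_eq hy]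
  simp only [hG.christoffel_expScale hφ hy, sum_conformal_christoffel_mul_apply, hP, hQ,
    hG.schouten_expScale hφ hy, mul_add, Finset.sum_add_distrib, hvQ, hΓQ,
    hG.pderiv_gradientSq hφ hy, hpp, hG.pderiv_metric hy]
  simp only [schoutenVariation, hh, hgs, hPs, hΓs _ j i]
  -- The part linear in `φ` is `hR`; the quadratic and cubic parts cancel identically.
  linear_combination -hR

end IsMetricOn

/-! ### From coordinates to the manifold, and the Hodge star. -/

variable {M : Type*} [TopologicalSpace M] [ChartedSpace E3 M] [IsManifold (𝓡 3) ∞ M]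

theorem eq_zero_of_sum_smul_coordVector_eq_zero (c : M) {y : E3}
    (hy : y ∈ (extChartAt (𝓡 3) c).target)
    {a : Fin 3 → ℝ} (ha : ∑ i, a i • coordVector c i y = 0) : a = 0 := by
  have hI : IsManifold (𝓡 3) 1 M := IsManifold.of_le (n := ∞) (by simp)
  have h := isInvertible_mfderivWithin_extChartAt_symm (I := 𝓡 3) (x := c) hy
  rw [ModelWithCorners.range_eq_univ, mfderivWithin_univ] at h
  have hinj := h.injective
  have h2 : mfderiv 𝓘(ℝ, E3) (𝓡 3) (extChartAt (𝓡 3) c).symm y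
      (∑ i, a i • (EuclideanSpace.single i (1 : ℝ) : E3)) = 0 := by
    let A : E3 →L[ℝ] TangentSpace (𝓡 3) ((extChartAt (𝓡 3) c).symm y) :=
      mfderiv 𝓘(ℝ, E3) (𝓡 3) (extChartAt (𝓡 3) c).symm y
    have hA : A (∑ i, a i • (EuclideanSpace.single i (1 : ℝ) : E3))
        = ∑ i, a i • A (EuclideanSpace.single i (1 : ℝ)) := by
      simp only [map_sum, map_smul]
    exact hA.trans ha
  have h3 := hinj (h2.trans (map_zero _).symm)
  funext j
  have h4 := congrArg (fun v : E3 => v j) h3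
  have h5 : (∑ i, a i • (EuclideanSpace.single i (1 : ℝ) : E3)).ofLp j = a j := by
    simp [Pi.single_apply]
  exact h5.symm.trans h4

/-- The field `∂ᵢ` is the tangent map of the inverse chart applied to a constant vector field, hence
smooth; the smooth section `g` is then evaluated on two such fields. On the open target, derivatives
within the set are plain derivatives. -/
theorem contDiffAt_chartMetric (g : Metric3 M) (c : M) {y : E3}
    (hy : y ∈ (extChartAt (𝓡 3) c).target) (i j : Fin 3) :
    ContDiffAt ℝ ∞ (fun z => chartMetric g c z i j) y := by
  have hI : IsManifold (𝓡 3) 1 M := IsManifold.of_le (n := ∞) (by simp)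
  have hopen : IsOpen (extChartAt (𝓡 3) c).target := isOpen_extChartAt_target c
  have hsymm : ContMDiffAt 𝓘(ℝ, E3) (𝓡 3) ∞ (extChartAt (𝓡 3) c).symm y :=
    (contMDiffOn_extChartAt_symm c).contMDiffAt (hopen.mem_nhds hy)
  have htan := ContMDiffOn.contMDiffOn_tangentMapWithin (m := ∞)
    (contMDiffOn_extChartAt_symm (n := ∞) (I := 𝓡 3) c) le_rfl hopen.uniqueMDiffOn
  have hvec : ∀ i, ContMDiffAt 𝓘(ℝ, E3) (𝓡 3).tangent ∞
      (fun z => (Bundle.TotalSpace.mk' E3 ((extChartAt (𝓡 3) c).symm z) (coordVector c i z) :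
        TangentBundle (𝓡 3) M)) y := by
    intro i
    have hconst : ContMDiffAt 𝓘(ℝ, E3) 𝓘(ℝ, E3).tangent ∞
        (fun z : E3 => (⟨z, EuclideanSpace.single i (1 : ℝ)⟩ : TangentBundle 𝓘(ℝ, E3) E3)) y :=
      contMDiffAt_vectorSpace_iff_contDiffAt.2 contDiffAt_const
    have htan' := (htan (⟨y, EuclideanSpace.single i (1 : ℝ)⟩ : TangentBundle 𝓘(ℝ, E3) E3)
      hy).contMDiffAt
      ((hopen.preimage (FiberBundle.continuous_proj E3 (TangentSpace 𝓘(ℝ, E3)))).mem_nhds hy)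
    refine (htan'.comp y hconst).congr_of_eventuallyEq ?_
    filter_upwards [hopen.mem_nhds hy] with z hz
    simp only [Function.comp_apply, tangentMapWithin, coordVector,
      mfderivWithin_of_isOpen hopen hz]
  have h : ContMDiffAt 𝓘(ℝ, E3) ((𝓡 3).prod 𝓘(ℝ)) ∞
      (fun z => Bundle.TotalSpace.mk' ℝ (E := Bundle.Trivial M ℝ) ((extChartAt (𝓡 3) c).symm z)
        (chartMetric g c z i j)) y := by
    apply ContMDiffAt.clm_bundle_apply₂ (F₁ := E3) (F₂ := E3)
    · exact (g.contMDiff _).comp y hsymm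
    · exact hvec i
    · exact hvec j
  exact (Bundle.contMDiffAt_totalSpace.1 h).2.contDiffAt

theorem isMetricOn_chartMetric (g : Metric3 M) (c : M) :
    IsMetricOn (chartMetric g c) (extChartAt (𝓡 3) c).target where
  isOpen := isOpen_extChartAt_target c
  smooth y hy i j := contDiffAt_chartMetric g c hy i j
  symm y _ i j := g.symm _ _ _
  det_ne_zero y hy hdet := by
    -- A kernel vector `a` of the Gram matrix yields a nonzero tangent vector `∑ aᵢ ∂ᵢ` with `g(v,
    -- v) = 0`, against positivity.
    obtain ⟨a, ha, h⟩ := Matrix.exists_mulVec_eq_zero_iff.2 hdet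
    set v := ∑ i, a i • coordVector c i y with hv
    have hv0 : v ≠ 0 := fun h0 => ha (eq_zero_of_sum_smul_coordVector_eq_zero c hy h0)
    have hpos := g.pos _ v hv0
    have hz : g.inner _ v v = ∑ i, a i * (Matrix.mulVec (chartMetric g c y) a) i := by
      simp only [hv, Matrix.mulVec, dotProduct, chartMetric, Matrix.of_apply, Fin.sum_univ_three,
        map_add, map_smul, _root_.add_apply, _root_.smul_apply,
        smul_eq_mul]
      ring
    rw [hz, h] at hpos
    simp at hpos

theorem chartMetric_conformal (g : Metric3 M) (f : C^∞⟮𝓡 3, M; 𝓘(ℝ, ℝ), ℝ⟯) (c : M) :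
    chartMetric (conformal g f) c
      = expScale (fun y => f ((extChartAt (𝓡 3) c).symm y)) (chartMetric g c) := by
  funext y
  ext i j
  rfl

theorem cottonForm_conformal (g : Metric3 M) (f : C^∞⟮𝓡 3, M; 𝓘(ℝ, ℝ), ℝ⟯) (x : M)
    (u v w : TangentSpace (𝓡 3) x) :
    cottonForm (conformal g f) x u v w = cottonForm g x u v w := by
  have hf : ∀ y ∈ (extChartAt (𝓡 3) x).target,
      ContDiffAt ℝ ∞ (fun y => f ((extChartAt (𝓡 3) x).symm y)) y := by
    intro y hy
    have hs : ContMDiffAt 𝓘(ℝ, E3) (𝓡 3) ∞ (extChartAt (𝓡 3) x).symm y :=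
      (contMDiffOn_extChartAt_symm x).contMDiffAt ((isOpen_extChartAt_target x).mem_nhds hy)
    exact ((f.contMDiff _).comp y hs).contDiffAt
  simp only [cottonForm, chartMetric_conformal,
    (isMetricOn_chartMetric g x).cottonComponent_expScale hf (mem_extChartAt_target x)]

/-- The Gram determinant scales by `e^{6t}` and its root by `e^{3t}`, while `g(u, eᵢ)` contributes
`e^{2t}`, so `e^{-t}` remains. The sign depends on the orientation alone. -/
theorem hodgeStar_scale {V : Type*} [AddCommGroup V] [Module ℝ V] (e : Module.Basis (Fin 3) ℝ V)
    (o : Orientation ℝ V (Fin 3)) (g α : V → V → ℝ) (t : ℝ) (u : V) :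
    hodgeStar e o (fun v w => Real.exp (2 * t) * g v w) α u
      = Real.exp (-t) * hodgeStar e o g α u := by
  have hm : (Matrix.of fun i j => Real.exp (2 * t) * g (e i) (e j))
      = Real.exp (2 * t) • Matrix.of fun i j => g (e i) (e j) := by
    ext i j; simp
  have hsq : Real.exp (2 * t) ^ 3 = Real.exp (3 * t) ^ 2 := by
    rw [← Real.exp_nat_mul, ← Real.exp_nat_mul]; ring_nf
  have hexp : Real.exp (2 * t) = Real.exp (-t) * Real.exp (3 * t) := by
    rw [← Real.exp_add]; ring_nf
  have h3 := Real.exp_ne_zero (3 * t)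
  unfold hodgeStar
  rw [hm, Matrix.det_smul, Fintype.card_fin, hsq, Real.sqrt_mul (sq_nonneg _),
    Real.sqrt_sq (Real.exp_pos _).le]
  simp only [mul_assoc, ← Finset.mul_sum]
  rw [hexp, div_mul_eq_div_div_swap, div_mul_eq_mul_div]
  field_simp

end CottonGeometry

end

theorem mainTheorem9 {M : Type*} [TopologicalSpace M] [ChartedSpace CottonGeometry.E3 M]
    [IsManifold (𝓡 3) ∞ M] (g : CottonGeometry.Metric3 M)
    (f : C^∞⟮𝓡 3, M; 𝓘(ℝ, ℝ), ℝ⟯) :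
    (∀ (o : ∀ x : M, Orientation ℝ (TangentSpace (𝓡 3) x) (Fin 3)) (x : M)
        (u w : TangentSpace (𝓡 3) x),
      CottonGeometry.cottonTensor (CottonGeometry.conformal g f) o x u w =
        Real.exp (-f x) * CottonGeometry.cottonTensor g o x u w) ∧
    (∀ (x : M) (u v w : TangentSpace (𝓡 3) x),
      CottonGeometry.cottonForm (CottonGeometry.conformal g f) x u v w =
        CottonGeometry.cottonForm g x u v w) := by
  refine ⟨fun o x u w => ?_, CottonGeometry.cottonForm_conformal g f⟩
  simp only [CottonGeometry.cottonTensor, CottonGeometry.cottonForm_conformal]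
  exact CottonGeometry.hodgeStar_scale _ _ _ _ _ _
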